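/- Let $q\in\mathbb{C}$ with $|q|<1$, and write $(q;q)_n=\prod_{i=1}^{n}(1-q^i)$ for $n\ge 0$ and $(q;q)_\infty=\prod_{i\ge 1}(1-q^i)$. Then the products $(q;q)_n$ ($n\ge 0$) are nonzero, the infinite product $(q;q)_\infty$ converges and is nonzero, both series below converge absolutely, and $$\sum_{n\ge 0}\frac{q^{n^2+2n}}{(q;q)_{2n+1}}=\frac{1}{(q;q)_\infty}\sum_{k\in\mathbb{Z}}\left(q^{15k^2-7k}-q^{15k^2+13k+2}\right).$$ -/

import Mathlib

/-- The finite `q`-shifted factorial `(a; q)_n = (1 - a)(1 - a q) ⋯ (1 - a q ^ (n - 1))`. -/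
def qPoch (a q : ℂ) (n : ℕ) : ℂ :=
  ∏ i ∈ Finset.range n, (1 - a * q ^ i)

/-- The infinite `q`-shifted factorial `(a; q)_∞ = ∏_{i ≥ 0} (1 - a q ^ i)`. The product converges
for `‖q‖ < 1`. -/
noncomputable def qPochInf (a q : ℂ) : ℂ :=
  ∏' i : ℕ, (1 - a * q ^ i)

open Filter Topology

/-! The identity comes from a Bailey pair. `hasSum_baileyTerm` writes `1/(q;q)_{2n+1}` as a finitely
supported alternating sum over `k` of powers of `q` times `1/((q;q)_{n+1-s} (q;q)_{n+1+s})`, with `s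
= 3k - 1` and `s = 3k + 1`. Multiply by `q^(n²+2n)`, sum over `n`, and exchange the sums
(`summable_pow_mul_baileyTerm`). By the Durfee rectangle identity `hasSum_durfee` each inner sum is
`q^(s²-1)/(q;q)_∞`, and adding `s² - 1` to the exponents `6k² - k` and `6k² + 7k + 2` gives those of
the theorem.

The Bailey expansion is deduced by `q`-Pascal rules from a finite pentagonal number theorem
(`hasSum_evenTerm`, `hasSum_oddTerm`) and its twisted variant `hasSum_twistedOddTerm`. -/

lemma HasSum.congr_terms {ι : Type*} {f g : ι → ℂ} {s : ℂ} (hg : HasSum g s)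
    (h : ∀ i, f i = g i) : HasSum f s := by
  rwa [funext h]

lemma HasSum.congr_sum {ι : Type*} {f : ι → ℂ} {s t : ℂ} (hf : HasSum f s)
    (h : s = t) : HasSum f t := h ▸ hf

/-! ### Convergence and non-vanishing of the `q`-factorials -/

lemma one_sub_mul_pow_ne_zero {q : ℂ} (hq : ‖q‖ < 1) (i : ℕ) : 1 - q * q ^ i ≠ 0 := by
  intro h
  have h1 : ‖q ^ (i + 1)‖ = 1 := by
    rw [pow_succ', ← sub_eq_zero.mp h, norm_one]
  rw [norm_pow] at h1
  exact absurd h1 (pow_lt_one₀ (norm_nonneg _) hq (Nat.succ_ne_zero i)).ne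

lemma qPoch_self_ne_zero {q : ℂ} (hq : ‖q‖ < 1) (n : ℕ) : qPoch q q n ≠ 0 :=
  Finset.prod_ne_zero_iff.mpr fun i _ => one_sub_mul_pow_ne_zero hq i

lemma summable_norm_neg_mul_pow {q : ℂ} (hq : ‖q‖ < 1) :
    Summable fun i : ℕ => ‖-(q * q ^ i)‖ := by
  simpa [norm_mul, norm_pow] using
    (summable_geometric_of_lt_one (norm_nonneg q) hq).mul_left ‖q‖

lemma multipliable_one_sub_mul_pow {q : ℂ} (hq : ‖q‖ < 1) :
    Multipliable fun i : ℕ => 1 - q * q ^ i := by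
  simpa [sub_eq_add_neg] using multipliable_one_add_of_summable (summable_norm_neg_mul_pow hq)

lemma qPochInf_self_ne_zero {q : ℂ} (hq : ‖q‖ < 1) : qPochInf q q ≠ 0 := by
  have h := tprod_one_add_ne_zero_of_summable (f := fun i : ℕ => -(q * q ^ i))
    (fun i => by simpa [sub_eq_add_neg] using one_sub_mul_pow_ne_zero hq i)
    (summable_norm_neg_mul_pow hq)
  simpa [qPochInf, sub_eq_add_neg] using h

lemma tendsto_inv_qPoch {q : ℂ} (hq : ‖q‖ < 1) :
    Tendsto (fun n => (qPoch q q n)⁻¹) atTop (𝓝 (qPochInf q q)⁻¹) :=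
  (multipliable_one_sub_mul_pow hq).hasProd.tendsto_prod_nat.inv₀ (qPochInf_self_ne_zero hq)

/-! ### Reciprocal `q`-factorials with integer index -/

/-- `1 / (q; q)_k`, extended by zero to negative `k`. -/
noncomputable def qInv (q : ℂ) (k : ℤ) : ℂ :=
  if k < 0 then 0 else (qPoch q q k.toNat)⁻¹

lemma qInv_of_neg (q : ℂ) {k : ℤ} (hk : k < 0) : qInv q k = 0 := if_pos hk

@[simp] lemma qInv_natCast (q : ℂ) (n : ℕ) : qInv q n = (qPoch q q n)⁻¹ := by
  simp [qInv]

@[simp] lemma qInv_zero (q : ℂ) : qInv q 0 = 1 := by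
  simp [qInv, qPoch]

/-- Extension by zero keeps the recursion valid at every integer: at `k = 0` the factor `1 - q^0`
matches the value zero at `-1`. Hence the Pascal rules need no boundary cases. -/
lemma one_sub_zpow_mul_qInv {q : ℂ} (hq : ‖q‖ < 1) (k : ℤ) :
    (1 - q ^ k) * qInv q k = qInv q (k - 1) := by
  rcases lt_trichotomy k 0 with hk | rfl | hk
  · rw [qInv_of_neg q hk, qInv_of_neg q (by omega), mul_zero]
  · rw [qInv_of_neg q (show (0 : ℤ) - 1 < 0 by norm_num), zpow_zero, sub_self, zero_mul]
  · obtain ⟨n, rfl⟩ : ∃ n : ℕ, k = (n + 1 : ℕ) := ⟨(k - 1).toNat, by omega⟩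
    have h1 : ((n + 1 : ℕ) : ℤ) - 1 = (n : ℕ) := by push_cast; ring
    rw [h1, qInv_natCast, qInv_natCast, zpow_natCast]
    have h2 : qPoch q q (n + 1) = qPoch q q n * (1 - q ^ (n + 1)) := by
      rw [qPoch, Finset.prod_range_succ, ← pow_succ', qPoch]
    have h3 : 1 - q ^ (n + 1) ≠ 0 := by
      rw [pow_succ']; exact one_sub_mul_pow_ne_zero hq n
    have h4 := qPoch_self_ne_zero hq n
    rw [h2]
    field_simp

lemma one_sub_zpow_natCast_ne_zero {q : ℂ} (hq : ‖q‖ < 1) (n : ℕ) :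
    1 - q ^ ((n : ℤ) + 1) ≠ 0 := by
  have := one_sub_mul_pow_ne_zero hq n
  rwa [← pow_succ', ← zpow_natCast, Nat.cast_succ] at this

lemma exists_norm_qInv_le {q : ℂ} (hq : ‖q‖ < 1) : ∃ C : ℝ, 0 ≤ C ∧ ∀ k, ‖qInv q k‖ ≤ C := by
  obtain ⟨C, hC⟩ := (tendsto_inv_qPoch hq).norm.bddAbove_range
  have hC0 : 0 ≤ C := (norm_nonneg _).trans (hC ⟨0, rfl⟩)
  refine ⟨C, hC0, fun k => ?_⟩
  rcases lt_or_ge k 0 with hk | hk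
  · rwa [qInv_of_neg q hk, norm_zero]
  · lift k to ℕ using hk
    rw [qInv_natCast]
    exact hC ⟨k, rfl⟩

/-- The `q`-Pascal rule for `1 / ((q; q)_a (q; q)_b)`. -/
lemma qInv_pascal {q : ℂ} (hq : ‖q‖ < 1) (h0 : q ≠ 0) (a b : ℤ) :
    (1 - q ^ (a + b)) * (qInv q a * qInv q b) =
      qInv q (a - 1) * qInv q b + q ^ a * (qInv q a * qInv q (b - 1)) := by
  rw [← one_sub_zpow_mul_qInv hq a, ← one_sub_zpow_mul_qInv hq b, zpow_add₀ h0]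
  ring

/-- The other `q`-Pascal rule for `1 / ((q; q)_a (q; q)_b)`. -/
lemma qInv_pascal' {q : ℂ} (hq : ‖q‖ < 1) (h0 : q ≠ 0) (a b : ℤ) :
    (1 - q ^ (a + b)) * (qInv q a * qInv q b) =
      qInv q a * qInv q (b - 1) + q ^ b * (qInv q (a - 1) * qInv q b) := by
  rw [← one_sub_zpow_mul_qInv hq a, ← one_sub_zpow_mul_qInv hq b, zpow_add₀ h0]
  ring

lemma summable_mul_qInv_mul_qInv (q : ℂ) (c : ℤ → ℂ) (a b : ℤ) :
    Summable fun k : ℤ => c k * (qInv q (a - 3 * k) * qInv q (b + 3 * k)) := by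
  refine summable_of_ne_finset_zero (s := Finset.Icc (-|b|) |a|) fun k hk => ?_
  have h : a - 3 * k < 0 ∨ b + 3 * k < 0 := by
    by_contra! h
    refine hk (Finset.mem_Icc.mpr ⟨?_, ?_⟩)
    · rcases abs_cases b with hb | hb <;> omega
    · rcases abs_cases a with ha | ha <;> omega
  rcases h with h | h <;> simp [qInv_of_neg q h]

/-! ### A finite form of the pentagonal number theorem -/

/-- Summand of the finite pentagonal number theorem of even order `2 m`. -/
noncomputable def evenTerm (q : ℂ) (m k : ℤ) : ℂ :=
  q ^ (6 * k ^ 2 + k) * (qInv q (m - 3 * k) * qInv q (m + 3 * k)) -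
    q ^ (6 * k ^ 2 + 7 * k + 2) * (qInv q (m - 2 - 3 * k) * qInv q (m + 2 + 3 * k))

/-- Summand of the finite pentagonal number theorem of odd order `2 m + 1`. -/
noncomputable def oddTerm (q : ℂ) (m k : ℤ) : ℂ :=
  q ^ (6 * k ^ 2 + k) * (qInv q (m - 3 * k) * qInv q (m + 1 + 3 * k)) -
    q ^ (6 * k ^ 2 + 7 * k + 2) * (qInv q (m - 1 - 3 * k) * qInv q (m + 2 + 3 * k))

/-- Opposite Pascal rules on the two products leave the same cross term with equal weights, so it
cancels for each `k`. -/
lemma one_sub_mul_oddTerm {q : ℂ} (hq : ‖q‖ < 1) (h0 : q ≠ 0) (m k : ℤ) :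
    (1 - q ^ (2 * m + 1)) * oddTerm q m k = evenTerm q m k := by
  have p1 := qInv_pascal' hq h0 (m - 3 * k) (m + 1 + 3 * k)
  have p2 := qInv_pascal hq h0 (m - 1 - 3 * k) (m + 2 + 3 * k)
  rw [show m - 3 * k + (m + 1 + 3 * k) = 2 * m + 1 by ring,
    show m + 1 + 3 * k - 1 = m + 3 * k by ring, show m - 3 * k - 1 = m - 1 - 3 * k by ring] at p1
  rw [show m - 1 - 3 * k + (m + 2 + 3 * k) = 2 * m + 1 by ring,
    show m + 2 + 3 * k - 1 = m + 1 + 3 * k by ring,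
    show m - 1 - 3 * k - 1 = m - 2 - 3 * k by ring] at p2
  have e : q ^ (6 * k ^ 2 + k) * q ^ (m + 1 + 3 * k) =
      q ^ (6 * k ^ 2 + 7 * k + 2) * q ^ (m - 1 - 3 * k) := by
    rw [← zpow_add₀ h0, ← zpow_add₀ h0]; congr 1; ring
  rw [oddTerm, evenTerm]
  linear_combination q ^ (6 * k ^ 2 + k) * p1 - q ^ (6 * k ^ 2 + 7 * k + 2) * p2 +
    qInv q (m - 1 - 3 * k) * qInv q (m + 1 + 3 * k) * e

/-- The terms by which consecutive orders of the finite pentagonal number theorem differ. -/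
noncomputable def shiftTerm (q : ℂ) (m k : ℤ) : ℂ :=
  q ^ (m + 6 * k ^ 2 - 2 * k + 1) * (qInv q (m + 1 - 3 * k) * qInv q (m + 3 * k))

/-- Here the cross terms cancel only after summation: they telescope in `k`. -/
lemma one_sub_mul_evenTerm {q : ℂ} (hq : ‖q‖ < 1) (h0 : q ≠ 0) (m k : ℤ) :
    (1 - q ^ (2 * m + 2)) * evenTerm q (m + 1) k =
      oddTerm q m k + (shiftTerm q m k - shiftTerm q m (k + 1)) := by
  have p1 := qInv_pascal hq h0 (m + 1 - 3 * k) (m + 1 + 3 * k)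
  have p2 := qInv_pascal' hq h0 (m + 1 - 2 - 3 * k) (m + 1 + 2 + 3 * k)
  rw [show m + 1 - 3 * k + (m + 1 + 3 * k) = 2 * m + 2 by ring,
    show m + 1 + 3 * k - 1 = m + 3 * k by ring, show m + 1 - 3 * k - 1 = m - 3 * k by ring] at p1
  rw [show m + 1 - 2 - 3 * k + (m + 1 + 2 + 3 * k) = 2 * m + 2 by ring,
    show m + 1 + 2 + 3 * k - 1 = m + 2 + 3 * k by ring] at p2
  have e1 : q ^ (6 * k ^ 2 + k) * q ^ (m + 1 - 3 * k) = q ^ (m + 6 * k ^ 2 - 2 * k + 1) := by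
    rw [← zpow_add₀ h0]; congr 1; ring
  have e2 : q ^ (6 * k ^ 2 + 7 * k + 2) * q ^ (m + 1 + 2 + 3 * k) =
      q ^ (m + 6 * (k + 1) ^ 2 - 2 * (k + 1) + 1) := by
    rw [← zpow_add₀ h0]; congr 1; ring
  rw [oddTerm, evenTerm, shiftTerm, shiftTerm, ← e1, ← e2,
    show m + 1 - 3 * (k + 1) = m + 1 - 2 - 3 * k - 1 by ring,
    show m + 3 * (k + 1) = m + 1 + 2 + 3 * k by ring,
    show m - 1 - 3 * k = m + 1 - 2 - 3 * k by ring]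
  linear_combination q ^ (6 * k ^ 2 + k) * p1 - q ^ (6 * k ^ 2 + 7 * k + 2) * p2

lemma hasSum_of_mul_left {f g : ℤ → ℂ} {c s : ℂ} (hc : c ≠ 0) (hg : HasSum g (c * s))
    (h : ∀ k, c * f k = g k) : HasSum f s := by
  rw [← hasSum_mul_left_iff hc]
  exact hg.congr_terms h

lemma hasSum_oddTerm_of_evenTerm {q : ℂ} (hq : ‖q‖ < 1) (h0 : q ≠ 0) (m : ℕ)
    (h : HasSum (evenTerm q m) (qInv q (2 * m))) :
    HasSum (oddTerm q m) (qInv q (2 * m + 1)) := by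
  refine hasSum_of_mul_left (c := 1 - q ^ (2 * (m : ℤ) + 1)) ?_ ?_
    (one_sub_mul_oddTerm hq h0 m)
  · exact_mod_cast one_sub_zpow_natCast_ne_zero hq (2 * m)
  · rwa [one_sub_zpow_mul_qInv hq, add_sub_cancel_right]

lemma hasSum_evenTerm {q : ℂ} (hq : ‖q‖ < 1) (h0 : q ≠ 0) (m : ℕ) :
    HasSum (evenTerm q m) (qInv q (2 * m)) := by
  induction m with
  | zero =>
    have h : ∀ k : ℤ, k ≠ 0 → evenTerm q (0 : ℕ) k = 0 := fun k hk => by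
      have h1 : qInv q (0 - 3 * k) * qInv q (0 + 3 * k) = 0 := by
        rcases lt_or_gt_of_ne hk with h | h
        · rw [qInv_of_neg q (k := 0 + 3 * k) (by omega), mul_zero]
        · rw [qInv_of_neg q (k := 0 - 3 * k) (by omega), zero_mul]
      have h2 : qInv q (0 - 2 - 3 * k) * qInv q (0 + 2 + 3 * k) = 0 := by
        rcases lt_or_gt_of_ne hk with h | h
        · rw [qInv_of_neg q (k := 0 + 2 + 3 * k) (by omega), mul_zero]
        · rw [qInv_of_neg q (k := 0 - 2 - 3 * k) (by omega), zero_mul]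
      simp only [evenTerm, Nat.cast_zero, h1, h2, mul_zero, sub_zero]
    have h' := hasSum_single 0 h
    have h2 : evenTerm q (0 : ℕ) 0 = qInv q (2 * (0 : ℕ)) := by
      -- At `k = 0` the second product contains the index `-2`, so only the first survives.
      simp [evenTerm, qInv_of_neg q (k := -2) (by omega)]
    rwa [h2] at h'
  | succ m ih =>
    have hodd := hasSum_oddTerm_of_evenTerm hq h0 m ih
    have hs : Summable (shiftTerm q m) :=
      summable_mul_qInv_mul_qInv q _ ((m : ℤ) + 1) m
    have hshift : HasSum (fun k => shiftTerm q m k - shiftTerm q m (k + 1)) 0 := by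
      have := hs.hasSum.sub ((Equiv.addRight (1 : ℤ)).hasSum_iff.mpr hs.hasSum)
      rwa [sub_self] at this
    rw [Nat.cast_succ]
    refine hasSum_of_mul_left (c := 1 - q ^ (2 * (m : ℤ) + 2)) ?_ ?_
      (one_sub_mul_evenTerm hq h0 m)
    · exact_mod_cast one_sub_zpow_natCast_ne_zero hq (2 * m + 1)
    · have := hodd.add hshift
      rwa [add_zero, show 2 * (m : ℤ) + 1 = 2 * m + 2 - 1 by ring,
        ← one_sub_zpow_mul_qInv hq] at this

lemma hasSum_oddTerm {q : ℂ} (hq : ‖q‖ < 1) (h0 : q ≠ 0) (m : ℕ) :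
    HasSum (oddTerm q m) (qInv q (2 * m + 1)) :=
  hasSum_oddTerm_of_evenTerm hq h0 m (hasSum_evenTerm hq h0 m)

/-! ### The Bailey pair with `β_n = 1 / (q; q)_{2 n + 1}` -/

/-- With the Pascal rules swapped relative to `one_sub_mul_oddTerm`, the unweighted parts cancel and
the weighted ones form `q^m` times the even summand. -/
lemma hasSum_twistedOddTerm {q : ℂ} (hq : ‖q‖ < 1) (h0 : q ≠ 0) (m : ℕ) :
    HasSum (fun k : ℤ =>
      q ^ (6 * k ^ 2 + 4 * k) * (qInv q (m - 3 * k) * qInv q (m + 1 + 3 * k)) -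
        q ^ (6 * k ^ 2 + 4 * k) * (qInv q (m - 1 - 3 * k) * qInv q (m + 2 + 3 * k)))
      (q ^ (m : ℤ) * qInv q (2 * m + 1)) := by
  refine hasSum_of_mul_left (c := 1 - q ^ (2 * (m : ℤ) + 1))
    (g := fun k => q ^ (m : ℤ) * evenTerm q m k) ?_ ?_ fun k => ?_
  · exact_mod_cast one_sub_zpow_natCast_ne_zero hq (2 * m)
  · rw [mul_left_comm, one_sub_zpow_mul_qInv hq, add_sub_cancel_right]
    exact (hasSum_evenTerm hq h0 m).mul_left _
  · generalize (m : ℤ) = m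
    have p1 := qInv_pascal hq h0 (m - 3 * k) (m + 1 + 3 * k)
    have p2 := qInv_pascal' hq h0 (m - 1 - 3 * k) (m + 2 + 3 * k)
    rw [show m - 3 * k + (m + 1 + 3 * k) = 2 * m + 1 by ring,
      show m + 1 + 3 * k - 1 = m + 3 * k by ring,
      show m - 3 * k - 1 = m - 1 - 3 * k by ring] at p1
    rw [show m - 1 - 3 * k + (m + 2 + 3 * k) = 2 * m + 1 by ring,
      show m + 2 + 3 * k - 1 = m + 1 + 3 * k by ring,
      show m - 1 - 3 * k - 1 = m - 2 - 3 * k by ring] at p2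
    have e1 : q ^ (6 * k ^ 2 + 4 * k) * q ^ (m - 3 * k) = q ^ m * q ^ (6 * k ^ 2 + k) := by
      rw [← zpow_add₀ h0, ← zpow_add₀ h0]; congr 1; ring
    have e2 : q ^ (6 * k ^ 2 + 4 * k) * q ^ (m + 2 + 3 * k) =
        q ^ m * q ^ (6 * k ^ 2 + 7 * k + 2) := by
      rw [← zpow_add₀ h0, ← zpow_add₀ h0]; congr 1; ring
    rw [evenTerm]
    linear_combination q ^ (6 * k ^ 2 + 4 * k) * p1 - q ^ (6 * k ^ 2 + 4 * k) * p2 +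
      qInv q (m - 3 * k) * qInv q (m + 3 * k) * e1 -
      qInv q (m - 2 - 3 * k) * qInv q (m + 2 + 3 * k) * e2

/-- Summand of the finite identity behind `β_n = 1 / (q; q)_{2 n + 1}`. -/
noncomputable def baileyTerm (q : ℂ) (m k : ℤ) : ℂ :=
  q ^ (6 * k ^ 2 - k) * (qInv q (m + 2 - 3 * k) * qInv q (m + 3 * k)) -
    q ^ (6 * k ^ 2 + 7 * k + 2) * (qInv q (m - 3 * k) * qInv q (m + 2 + 3 * k))

lemma hasSum_comp_neg {f : ℤ → ℂ} (hf : Summable f) : HasSum (fun k => f (-k)) (∑' k, f k) :=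
  (Equiv.neg ℤ).hasSum_iff.mpr hf.hasSum

lemma hasSum_baileyTerm {q : ℂ} (hq : ‖q‖ < 1) (h0 : q ≠ 0) (m : ℕ) :
    HasSum (baileyTerm q m) (qInv q (2 * m + 1)) := by
  have sx1 := summable_mul_qInv_mul_qInv q (fun k => q ^ (6 * k ^ 2 + k)) m (m + 1)
  have sx2 := summable_mul_qInv_mul_qInv q (fun k => q ^ (6 * k ^ 2 + 7 * k + 2)) (m - 1) (m + 2)
  have sy1 := summable_mul_qInv_mul_qInv q (fun k => q ^ (6 * k ^ 2 + 4 * k)) m (m + 1)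
  have sy2 := summable_mul_qInv_mul_qInv q (fun k => q ^ (6 * k ^ 2 + 4 * k)) (m - 1) (m + 2)
  have hx := (sx1.hasSum.sub sx2.hasSum).unique (hasSum_oddTerm hq h0 m)
  have hy := (sy1.hasSum.sub sy2.hasSum).unique (hasSum_twistedOddTerm hq h0 m)
  -- Replacing `k` by `-k` in one half of each sum matches the Pascal pieces of `baileyTerm`. The
  -- total is `(1 - q^(m+2) q^m)/(q;q)_{2m+1}`, which supplies the factor `1 - q^(2m+2)`.
  have h := ((hasSum_comp_neg sx1).sub sx2.hasSum).sub
    ((sy1.hasSum.sub (hasSum_comp_neg sy2)).mul_left (q ^ ((m : ℤ) + 2)))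
  rw [hx, hy] at h
  refine hasSum_of_mul_left (c := 1 - q ^ (2 * (m : ℤ) + 2)) ?_ (h.congr_sum ?_) fun k => ?_
  · exact_mod_cast one_sub_zpow_natCast_ne_zero hq (2 * m + 1)
  · have e : q ^ ((m : ℤ) + 2) * q ^ (m : ℤ) = q ^ (2 * (m : ℤ) + 2) := by
      rw [← zpow_add₀ h0]; congr 1; ring
    linear_combination -qInv q (2 * m + 1) * e
  · generalize (m : ℤ) = m
    have p1 := qInv_pascal hq h0 (m + 2 - 3 * k) (m + 3 * k)
    have p2 := qInv_pascal hq h0 (m - 3 * k) (m + 2 + 3 * k)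
    rw [show m + 2 - 3 * k + (m + 3 * k) = 2 * m + 2 by ring,
      show m + 2 - 3 * k - 1 = m + 1 + 3 * -k by ring,
      show m + 2 - 3 * k = m + 2 + 3 * -k by ring,
      show m + 3 * k - 1 = m - 1 - 3 * -k by ring,
      show m + 3 * k = m - 3 * -k by ring] at p1
    rw [show m - 3 * k + (m + 2 + 3 * k) = 2 * m + 2 by ring,
      show m + 2 + 3 * k - 1 = m + 1 + 3 * k by ring,
      show m - 3 * k - 1 = m - 1 - 3 * k by ring] at p2
    have e1 : q ^ (6 * k ^ 2 - k) * q ^ (m + 2 + 3 * -k) =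
        q ^ (m + 2) * q ^ (6 * (-k) ^ 2 + 4 * -k) := by
      rw [← zpow_add₀ h0, ← zpow_add₀ h0]; congr 1; ring
    have e2 : q ^ (6 * k ^ 2 + 7 * k + 2) * q ^ (m - 3 * k) =
        q ^ (m + 2) * q ^ (6 * k ^ 2 + 4 * k) := by
      rw [← zpow_add₀ h0, ← zpow_add₀ h0]; congr 1; ring
    rw [baileyTerm, show m + 2 - 3 * k = m + 2 + 3 * -k by ring,
      show m + 3 * k = m - 3 * -k by ring,
      show 6 * (-k) ^ 2 + -k = 6 * k ^ 2 - k by ring]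
    linear_combination q ^ (6 * k ^ 2 - k) * p1 - q ^ (6 * k ^ 2 + 7 * k + 2) * p2 +
      qInv q (m + 2 + 3 * -k) * qInv q (m - 1 - 3 * -k) * e1 -
      qInv q (m - 3 * k) * qInv q (m + 1 + 3 * k) * e2

/-! ### The Durfee rectangle identity -/

lemma summable_pow_sq {r : ℝ} (h0 : 0 ≤ r) (h1 : r < 1) : Summable fun i : ℕ => r ^ (i ^ 2) :=
  (summable_geometric_of_lt_one h0 h1).of_nonneg_of_le (fun _ => by positivity) fun i =>
    pow_le_pow_of_le_one h0 h1.le (Nat.le_self_pow two_ne_zero i)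

/-- Summand of the Durfee rectangle identity. -/
noncomputable def durfeeTerm (q : ℂ) (N i : ℕ) : ℂ :=
  q ^ (i ^ 2 + i * N) * (qInv q i * qInv q (i + N : ℕ))

lemma exists_norm_durfeeTerm_le {q : ℂ} (hq : ‖q‖ < 1) :
    ∃ C : ℝ, ∀ N i, ‖durfeeTerm q N i‖ ≤ ‖q‖ ^ (i ^ 2) * C := by
  obtain ⟨C, hC0, hC⟩ := exists_norm_qInv_le hq
  refine ⟨C * C, fun N i => ?_⟩
  rw [durfeeTerm, norm_mul, norm_mul, norm_pow]
  gcongr ?_ * (?_ * ?_)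
  · exact pow_le_pow_of_le_one (norm_nonneg _) hq.le (Nat.le_add_right _ _)
  · exact hC _
  · exact hC _

lemma summable_durfeeTerm {q : ℂ} (hq : ‖q‖ < 1) (N : ℕ) : Summable (durfeeTerm q N) := by
  obtain ⟨C, hC⟩ := exists_norm_durfeeTerm_le hq
  exact .of_norm_bounded ((summable_pow_sq (norm_nonneg q) hq).mul_right C) (hC N)

/-- Only `i = 0` survives as `N → ∞`; the domination is by a multiple of `‖q‖^(i²)`. -/
lemma tendsto_tsum_durfeeTerm {q : ℂ} (hq : ‖q‖ < 1) :
    Tendsto (fun N => ∑' i, durfeeTerm q N i) atTop (𝓝 (qPochInf q q)⁻¹) := by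
  obtain ⟨C, hC⟩ := exists_norm_durfeeTerm_le hq
  have h := tendsto_tsum_of_dominated_convergence (𝓕 := atTop) (f := durfeeTerm q)
    (g := fun i => if i = 0 then (qPochInf q q)⁻¹ else 0)
    ((summable_pow_sq (norm_nonneg q) hq).mul_right C) (fun i => ?_)
    (Eventually.of_forall hC)
  · rwa [tsum_ite_eq] at h
  · rcases Nat.eq_zero_or_pos i with rfl | hi
    · simpa [durfeeTerm] using tendsto_inv_qPoch hq
    · obtain ⟨D, hD0, hD⟩ := exists_norm_qInv_le hq
      rw [if_neg hi.ne']
      have ht : Tendsto (fun N : ℕ => ‖q‖ ^ N * (D * D)) atTop (𝓝 0) := by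
        simpa using (tendsto_pow_atTop_nhds_zero_of_lt_one (norm_nonneg q) hq).mul_const (D * D)
      refine squeeze_zero_norm (fun N => ?_) ht
      rw [durfeeTerm, norm_mul, norm_mul, norm_pow]
      gcongr ?_ * (?_ * ?_)
      · exact pow_le_pow_of_le_one (norm_nonneg _) hq.le (by nlinarith [Nat.zero_le (i ^ 2)])
      · exact hD _
      · exact hD _

lemma tsum_durfeeTerm_sub_succ {q : ℂ} (hq : ‖q‖ < 1) (N : ℕ) :
    ∑' i, durfeeTerm q N i - ∑' i, durfeeTerm q (N + 1) i =
      q ^ (N + 1) * (∑' i, durfeeTerm q (N + 2) i - ∑' i, durfeeTerm q (N + 1) i) := by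
  have s0 := (summable_durfeeTerm hq N).hasSum
  have s1 := (summable_durfeeTerm hq (N + 1)).hasSum
  have s2 := (summable_durfeeTerm hq (N + 2)).hasSum
  have hshift : HasSum (fun i : ℕ => q ^ (i ^ 2 + i * N) *
      (qInv q ((i : ℤ) - 1) * qInv q (i + N + 1 : ℕ)))
      (q ^ (N + 1) * ∑' i, durfeeTerm q (N + 2) i) := by
    -- The `i = 0` term vanishes, so the index can be shifted by one.
    rw [← hasSum_nat_add_iff' 1]
    simp only [Finset.range_one, Finset.sum_singleton, Nat.cast_zero, zero_sub,
      qInv_of_neg q (show (-1 : ℤ) < 0 by norm_num), zero_mul, mul_zero, sub_zero]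
    refine (s2.mul_left (q ^ (N + 1))).congr_terms fun i => ?_
    rw [durfeeTerm, Nat.cast_succ, add_sub_cancel_right,
      show i + 1 + N + 1 = i + (N + 2) by ring]
    ring
  refine (s0.sub s1).unique ?_
  rw [mul_sub]
  refine (hshift.sub (s1.mul_left (q ^ (N + 1)))).congr_terms fun i => ?_
  have h1 := one_sub_zpow_mul_qInv hq i
  have h2 := one_sub_zpow_mul_qInv hq (i + N + 1 : ℕ)
  rw [zpow_natCast] at h1 h2
  rw [show ((i + N + 1 : ℕ) : ℤ) - 1 = (i + N : ℕ) by push_cast; ring] at h2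
  simp only [durfeeTerm]
  rw [← h1, ← h2, ← add_assoc]
  ring

/-- By `tsum_durfeeTerm_sub_succ` the increments of `S` do not decrease in norm, yet they tend to
zero because `S` converges. So they all vanish, and `S` equals its limit. -/
lemma hasSum_durfeeTerm {q : ℂ} (hq : ‖q‖ < 1) (N : ℕ) :
    HasSum (durfeeTerm q N) (qPochInf q q)⁻¹ := by
  set S : ℕ → ℂ := fun N => ∑' i, durfeeTerm q N i with hS
  have hlim : Tendsto S atTop (𝓝 (qPochInf q q)⁻¹) := tendsto_tsum_durfeeTerm hq
  have hmono : Monotone fun N => ‖S N - S (N + 1)‖ := monotone_nat_of_le_succ fun N => by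
    rw [hS]
    simp only
    rw [tsum_durfeeTerm_sub_succ hq N, norm_mul, norm_pow, norm_sub_rev]
    exact mul_le_of_le_one_left (norm_nonneg _) (pow_le_one₀ (norm_nonneg _) hq.le)
  have hdiff : Tendsto (fun N => ‖S N - S (N + 1)‖) atTop (𝓝 0) := by
    simpa using (hlim.sub (hlim.comp (tendsto_add_atTop_nat 1))).norm
  have hstep : ∀ N, S (N + 1) = S N := fun N =>
    (sub_eq_zero.mp (norm_le_zero_iff.mp (hmono.ge_of_tendsto hdiff N))).symm
  have hconst : ∀ M, S (M + N) = S N := fun M => by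
    induction M with
    | zero => rw [zero_add]
    | succ M ih => rw [Nat.succ_add, hstep, ih]
  have hval : S N = (qPochInf q q)⁻¹ :=
    tendsto_nhds_unique (by simp only [Function.comp_def, hconst]; exact tendsto_const_nhds)
      (hlim.comp (tendsto_add_atTop_nat N))
  exact hval ▸ (summable_durfeeTerm hq N).hasSum

lemma hasSum_durfee_of_pos {q : ℂ} (hq : ‖q‖ < 1) (N : ℕ) :
    HasSum (fun n : ℕ => q ^ (n ^ 2 + 2 * n) * (qInv q (n - N) * qInv q (n + 2 + N)))
      (q ^ (N ^ 2 + 2 * N) * (qPochInf q q)⁻¹) := by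
  rw [← (add_left_injective N).hasSum_iff]
  · refine ((hasSum_durfeeTerm hq (2 * N + 2)).mul_left (q ^ (N ^ 2 + 2 * N))).congr_terms fun i => ?_
    have h1 : ((i + N : ℕ) : ℤ) - N = (i : ℕ) := by push_cast; ring
    have h2 : ((i + N : ℕ) : ℤ) + 2 + N = (i + (2 * N + 2) : ℕ) := by push_cast; ring
    simp only [Function.comp_apply, durfeeTerm, h1, h2]
    ring
  · intro n hn
    have h : (n : ℤ) - N < 0 := by
      by_contra! h
      exact hn ⟨n - N, Nat.sub_add_cancel (by omega)⟩
    rw [qInv_of_neg q h, zero_mul, mul_zero]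

/-- For `s = 0` the sum would lack the empty-rectangle term, index `n = -1`; this never matters for
`s = 3k ± 1`. -/
lemma hasSum_durfee {q : ℂ} (hq : ‖q‖ < 1) {s : ℤ} (hs : s ≠ 0) :
    HasSum (fun n : ℕ => q ^ (n ^ 2 + 2 * n) * (qInv q (n + 1 - s) * qInv q (n + 1 + s)))
      (q ^ (s ^ 2 - 1) * (qPochInf q q)⁻¹) := by
  rcases lt_or_gt_of_ne hs with h | h
  · obtain ⟨N, rfl⟩ : ∃ N : ℕ, s = -(N + 1) := ⟨(-s - 1).toNat, by omega⟩
    have e : (-((N : ℤ) + 1)) ^ 2 - 1 = (N ^ 2 + 2 * N : ℕ) := by push_cast; ring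
    rw [e, zpow_natCast]
    refine (hasSum_durfee_of_pos hq N).congr_terms fun n => ?_
    rw [show (n : ℤ) + 1 - -(N + 1) = n + 2 + N by ring,
      show (n : ℤ) + 1 + -(N + 1) = n - N by ring, mul_comm (qInv q (n + 2 + N))]
  · obtain ⟨N, rfl⟩ : ∃ N : ℕ, s = N + 1 := ⟨(s - 1).toNat, by omega⟩
    have e : ((N : ℤ) + 1) ^ 2 - 1 = (N ^ 2 + 2 * N : ℕ) := by push_cast; ring
    rw [e, zpow_natCast]
    refine (hasSum_durfee_of_pos hq N).congr_terms fun n => ?_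
    rw [show (n : ℤ) + 1 - (N + 1) = n - N by ring,
      show (n : ℤ) + 1 + (N + 1) = n + 2 + N by ring]

/-! ### Summation of the double series -/

lemma summable_zpow_of_abs_le {r : ℝ} (h0 : 0 < r) (h1 : r < 1) {e : ℤ → ℤ}
    (he : ∀ k, |k| ≤ e k) : Summable fun k : ℤ => r ^ e k := by
  have hg : Summable fun k : ℤ => r ^ k.natAbs := by
    have := summable_geometric_of_lt_one h0.le h1
    exact .of_nat_of_neg (by simpa using this) (by simpa using this)
  refine hg.of_nonneg_of_le (fun k => by positivity) fun k => ?_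
  rw [← zpow_natCast, Int.natCast_natAbs]
  exact zpow_le_zpow_right_of_le_one₀ h0 h1.le (he k)

lemma norm_baileyTerm_le {q : ℂ} {C : ℝ} (hC : ∀ k, ‖qInv q k‖ ≤ C) (m k : ℤ) :
    ‖baileyTerm q m k‖ ≤
      (‖q‖ ^ (6 * k ^ 2 - k) + ‖q‖ ^ (6 * k ^ 2 + 7 * k + 2)) * (C * C) := by
  have h : ∀ a b, ‖qInv q a * qInv q b‖ ≤ C * C := fun a b => by
    rw [norm_mul]
    exact mul_le_mul (hC a) (hC b) (norm_nonneg _) ((norm_nonneg _).trans (hC a))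
  rw [baileyTerm, add_mul]
  refine (norm_sub_le _ _).trans ?_
  rw [norm_mul, norm_mul (q ^ (6 * k ^ 2 + 7 * k + 2)), norm_zpow, norm_zpow]
  gcongr <;> exact h _ _

lemma summable_pow_mul_baileyTerm {q : ℂ} (hq : ‖q‖ < 1) (h0 : q ≠ 0) :
    Summable fun p : ℕ × ℤ => q ^ (p.1 ^ 2 + 2 * p.1) * baileyTerm q p.1 p.2 := by
  obtain ⟨C, -, hC⟩ := exists_norm_qInv_le hq
  have hr : 0 < ‖q‖ := norm_pos_iff.mpr h0
  have s1 : Summable fun k : ℤ => ‖q‖ ^ (6 * k ^ 2 - k) :=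
    summable_zpow_of_abs_le hr hq fun k => by
      rcases abs_cases k with ⟨h, h'⟩ | ⟨h, h'⟩ <;> rw [h] <;> nlinarith
  have s2 : Summable fun k : ℤ => ‖q‖ ^ (6 * k ^ 2 + 7 * k + 2) :=
    summable_zpow_of_abs_le hr hq fun k => by
      rcases abs_cases k with ⟨h, h'⟩ | ⟨h, h'⟩ <;> rw [h]
      · nlinarith
      -- The hint is `(k+1)² ≥ 0`: `6k² + 8k + 2 = 6(k+1)² - 4(k+1)`, with equality in the bound at
      -- `k = -1`.
      · nlinarith [mul_nonneg (show 0 ≤ -k - 1 by omega) (show 0 ≤ -k - 1 by omega)]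
  have hk := (s1.add s2).mul_right (C * C)
  have hm := summable_pow_sq hr.le hq
  have hprod := hm.mul_of_nonneg hk (fun _ => by positivity)
    fun k => (norm_nonneg _).trans (norm_baileyTerm_le hC 0 k)
  refine .of_norm_bounded hprod fun p => ?_
  rw [norm_mul, norm_pow]
  exact mul_le_mul (pow_le_pow_of_le_one hr.le hq.le (Nat.le_add_right _ _))
    (norm_baileyTerm_le hC _ _) (norm_nonneg _) (by positivity)

lemma hasSum_pow_mul_baileyTerm {q : ℂ} (hq : ‖q‖ < 1) (h0 : q ≠ 0) (k : ℤ) :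
    HasSum (fun n : ℕ => q ^ (n ^ 2 + 2 * n) * baileyTerm q n k)
      ((q ^ (15 * k ^ 2 - 7 * k) - q ^ (15 * k ^ 2 + 13 * k + 2)) * (qPochInf q q)⁻¹) := by
  have h1 := (hasSum_durfee hq (s := 3 * k - 1) (by omega)).mul_left (q ^ (6 * k ^ 2 - k))
  have h2 := (hasSum_durfee hq (s := 3 * k + 1) (by omega)).mul_left (q ^ (6 * k ^ 2 + 7 * k + 2))
  have e1 : q ^ (6 * k ^ 2 - k) * q ^ ((3 * k - 1) ^ 2 - 1) = q ^ (15 * k ^ 2 - 7 * k) := by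
    rw [← zpow_add₀ h0]; congr 1; ring
  have e2 : q ^ (6 * k ^ 2 + 7 * k + 2) * q ^ ((3 * k + 1) ^ 2 - 1) =
      q ^ (15 * k ^ 2 + 13 * k + 2) := by
    rw [← zpow_add₀ h0]; congr 1; ring
  have h := h1.sub h2
  rw [← mul_assoc, ← mul_assoc, e1, e2, ← sub_mul] at h
  refine h.congr_terms fun n => ?_
  rw [baileyTerm, show (n : ℤ) + 1 - (3 * k - 1) = n + 2 - 3 * k by ring,
    show (n : ℤ) + 1 + (3 * k - 1) = n + 3 * k by ring,
    show (n : ℤ) + 1 - (3 * k + 1) = n - 3 * k by ring,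
    show (n : ℤ) + 1 + (3 * k + 1) = n + 2 + 3 * k by ring]
  ring

lemma exponents_ne_zero {k : ℤ} (hk : k ≠ 0) :
    15 * k ^ 2 - 7 * k ≠ 0 ∧ 15 * k ^ 2 + 13 * k + 2 ≠ 0 := by
  have h : 0 < k ^ 2 := by positivity
  constructor
  · rcases lt_or_gt_of_ne hk with h | h <;> nlinarith
  · rcases lt_or_gt_of_ne hk with h | h
    · nlinarith [mul_nonneg (show 0 ≤ -k - 1 by omega) (show 0 ≤ -k - 1 by omega)]
    · nlinarith

lemma hasSum_bilateral_zero :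
    HasSum (fun k : ℤ => (0 : ℂ) ^ (15 * k ^ 2 - 7 * k) - 0 ^ (15 * k ^ 2 + 13 * k + 2)) 1 := by
  have h := hasSum_single (f := fun k : ℤ =>
    (0 : ℂ) ^ (15 * k ^ 2 - 7 * k) - 0 ^ (15 * k ^ 2 + 13 * k + 2)) 0 fun k hk => by
      rw [zero_zpow _ (exponents_ne_zero hk).1, zero_zpow _ (exponents_ne_zero hk).2, sub_zero]
  simpa [zero_zpow] using h

lemma hasSum_unilateral_zero :
    HasSum (fun n : ℕ => (0 : ℂ) ^ (n ^ 2 + 2 * n) / qPoch 0 0 (2 * n + 1)) 1 := by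
  have h := hasSum_single (f := fun n : ℕ =>
    (0 : ℂ) ^ (n ^ 2 + 2 * n) / qPoch 0 0 (2 * n + 1)) 0 fun n hn => by
      rw [zero_pow (by positivity), zero_div]
  simpa [qPoch] using h

/-- The exponents `15 k² - 7 k` and `15 k² + 13 k + 2` are integers, and they are nonnegative for
every `k : ℤ`. The first four conjuncts say that both sides are meaningful: the denominators do not
vanish, and the infinite product and the bilateral series converge. -/
theorem corollary5p4 (q : ℂ) (hq : ‖q‖ < 1) :
    (∀ n : ℕ, qPoch q q n ≠ 0) ∧
    Multipliable (fun i : ℕ => 1 - q * q ^ i) ∧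
    qPochInf q q ≠ 0 ∧
    Summable (fun k : ℤ =>
      q ^ (15 * k ^ 2 - 7 * k : ℤ) - q ^ (15 * k ^ 2 + 13 * k + 2 : ℤ)) ∧
    HasSum (fun n : ℕ => q ^ (n ^ 2 + 2 * n) / qPoch q q (2 * n + 1))
      (1 / qPochInf q q *
        ∑' k : ℤ, (q ^ (15 * k ^ 2 - 7 * k : ℤ) - q ^ (15 * k ^ 2 + 13 * k + 2 : ℤ))) := by
  refine ⟨qPoch_self_ne_zero hq, multipliable_one_sub_mul_pow hq, qPochInf_self_ne_zero hq, ?_⟩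
  -- Adding integer exponents needs `q ≠ 0`; at `q = 0` only the zero exponents contribute and both
  -- sides are `1`.
  rcases eq_or_ne q 0 with rfl | h0
  · have h1 : qPochInf 0 0 = 1 := by simp [qPochInf]
    refine ⟨hasSum_bilateral_zero.summable, ?_⟩
    rw [hasSum_bilateral_zero.tsum_eq, h1, div_one, mul_one]
    exact hasSum_unilateral_zero
  · have hP := qPochInf_self_ne_zero hq
    have hs := summable_pow_mul_baileyTerm hq h0
    -- `hk` and `hn` evaluate the same double series, summing first over `n` and first over `k`
    -- respectively.
    have hk := ((Equiv.prodComm ℤ ℕ).hasSum_iff.mpr hs.hasSum).prod_fiberwise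
      (hasSum_pow_mul_baileyTerm hq h0)
    have hn := hs.hasSum.prod_fiberwise fun n : ℕ =>
      (hasSum_baileyTerm hq h0 n).mul_left (q ^ (n ^ 2 + 2 * n))
    have hsum := (summable_mul_right_iff (inv_ne_zero hP)).mp hk.summable
    refine ⟨hsum, ?_⟩
    rw [one_div, mul_comm, ← tsum_mul_right, hk.tsum_eq]
    refine hn.congr_terms fun n => ?_
    rw [div_eq_mul_inv, ← qInv_natCast]
    push_cast
    rfl
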